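/- Let $d\ge 3$, let $\mathbb S^{d-1}$ be the unit sphere of $\mathbb R^d$, and let $A$ be a real symmetric $d\times d$ matrix with eigenvalues $\lambda_1\ge\lambda_2\ge\dots\ge\lambda_d$ (with multiplicity) such that $\lambda_1=\lambda_2=\lambda_3=\lambda>0$ and $|\lambda_d|\le\lambda$. Let $\phi$ be a real function that is twice differentiable on $[-\lambda,\lambda]$ (one-sidedly at the end points), with $\phi'>0$ and $\phi''\ge 0$ on $[-\lambda,\lambda]$. For a Borel probability measure $\mu$ on $\mathbb S^{d-1}$ put $$\mathsf E_\phi[\mu]=\frac12\iint \phi(\langle Ax,y\rangle)\,d\mu(x)\,d\mu(y).$$ Then every local maximum $\mu$ of $\mathsf E_\phi$ over the space $\mathcal P(\mathbb S^{d-1})$ of Borel probability measures with the 2-Wasserstein distance $W_2$ (that is, every $\mu$ for which there is $\varepsilon>0$ with $\mathsf E_\phi[\nu]\le\mathsf E_\phi[\mu]$ whenever $W_2(\mu,\nu)<\varepsilon$) is a global maximum of $\mathsf E_\phi$. Moreover, the global maxima are exactly the point masses $\mu=\delta_{x_0}$ with $x_0\in\mathbb S^{d-1}$ and $Ax_0=\lambda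 x_0$. -/

import Mathlib

open MeasureTheory

noncomputable section

/-- The unit sphere of `ℝ^d`, with its Euclidean (chordal) distance and its Borel sets. -/
abbrev UnitSphere (d : ℕ) : Type :=
  Metric.sphere (0 : EuclideanSpace ℝ (Fin d)) 1

/-- The matrix-vector product `A x` for `x ∈ ℝ^d`. -/
abbrev mulVecE {d : ℕ} (A : Matrix (Fin d) (Fin d) ℝ) (x : EuclideanSpace ℝ (Fin d)) :
    EuclideanSpace ℝ (Fin d) :=
  Matrix.toEuclideanLin A x

/-- A real symmetric matrix acts as a symmetric operator on `ℝ^d`. -/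
theorem symmOperator {d : ℕ} {A : Matrix (Fin d) (Fin d) ℝ} (hA : A.IsSymm) :
    (Matrix.toEuclideanLin A).IsSymmetric := by
  rw [Matrix.isSymmetric_toEuclideanLin_iff, Matrix.IsHermitian,
    Matrix.conjTranspose_eq_transpose_of_trivial]
  exact hA

/-- The eigenvalues `λ_1 ≥ λ_2 ≥ … ≥ λ_d` of a real symmetric matrix, counted with multiplicity,
in decreasing order; `sortedEigenvalue hA i` is `λ_{i+1}`. -/
def sortedEigenvalue {d : ℕ} {A : Matrix (Fin d) (Fin d) ℝ} (hA : A.IsSymm) : Fin d → ℝ :=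
  (symmOperator hA).eigenvalues finrank_euclideanSpace_fin

/-- The interaction energy `E_φ[μ] = ½ ∬ φ(⟨A x, y⟩) dμ(x) dμ(y)`. -/
def interactionEnergy {d : ℕ} (A : Matrix (Fin d) (Fin d) ℝ) (φ : ℝ → ℝ)
    (μ : ProbabilityMeasure (UnitSphere d)) : ℝ :=
  (1 / 2 : ℝ) * ∫ x : UnitSphere d, ∫ y : UnitSphere d,
    φ (inner ℝ (mulVecE A (x : EuclideanSpace ℝ (Fin d))) (y : EuclideanSpace ℝ (Fin d)))
      ∂(μ : Measure (UnitSphere d)) ∂(μ : Measure (UnitSphere d))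

/-- The couplings of two probability measures. -/
def couplings {X : Type*} [MeasurableSpace X] (μ ν : ProbabilityMeasure X) :
    Set (Measure (X × X)) :=
  {γ | γ.map Prod.fst = (μ : Measure X) ∧ γ.map Prod.snd = (ν : Measure X)}

open scoped ENNReal in
/-- The 2-Wasserstein distance
`W_2(μ, ν) = (inf over couplings γ of μ and ν of ∬ dist(x, y)² dγ(x, y))^{1/2}`. -/
def wasserstein2 {X : Type*} [MeasurableSpace X] [PseudoEMetricSpace X]
    (μ ν : ProbabilityMeasure X) : ℝ≥0∞ :=
  (⨅ γ ∈ couplings μ ν, ∫⁻ p, edist p.1 p.2 ^ 2 ∂γ) ^ (1 / 2 : ℝ)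

/-- `μ` is a local maximum of the functional `E` for the distance `W_2`. -/
def IsWassersteinLocalMax {X : Type*} [MeasurableSpace X] [PseudoEMetricSpace X]
    (E : ProbabilityMeasure X → ℝ) (μ : ProbabilityMeasure X) : Prop :=
  ∃ ε > 0, ∀ ν : ProbabilityMeasure X, wasserstein2 μ ν < ε → E ν ≤ E μ

/-- `μ` is a global maximum of the functional `E`. -/
def IsGlobalMax {X : Type*} [MeasurableSpace X]
    (E : ProbabilityMeasure X → ℝ) (μ : ProbabilityMeasure X) : Prop :=
  ∀ ν : ProbabilityMeasure X, E ν ≤ E μ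

end

/-! The conformal flow of the sphere towards a unit vector `v` is a Lorentz boost of the light cone
followed by renormalization. If `A v = lam • v`, the boost preserves the form `lam * x₀ * y₀ - ⟨A x,
y⟩`, so the flow merely divides the deficit `lam - ⟨A x, y⟩` by the two normalizing factors
(`sub_inner_conformalFlow`).

Convexity of `φ` bounds each energy gain below by its tangent. Adding the flows for `S` and `-S`
cancels the first order term and leaves, up to a positive weight times the deficit, the coefficient
`1 - a² - b² - a b` with `a = ⟨x, v⟩`, `b = ⟨y, v⟩` (`two_sided_gain_lower_bound`). Summed over
three orthonormal eigenvectors it is nonnegative, and it vanishes only if `x = y` lies in their span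
(`conformalHessian_eq`), where the deficit is zero.

At a local maximum no small flow gains energy, so weight times deficit times coefficient integrates
to zero and the deficit vanishes almost everywhere for `μ ⊗ μ`. Equality in Cauchy–Schwarz then
forces a point mass at an eigenvector. Since `φ` increases strictly and `⟨A x, y⟩ ≤ lam`, zero
deficit also characterizes the global maxima. -/

section Convexity

/-! ### Monotonicity and tangent lines of `φ` -/

variable {φ : ℝ → ℝ}

theorem derivWithin_Icc_eq_deriv_of_mem_Ioo (g : ℝ → ℝ) {a b s : ℝ} (hs : s ∈ Set.Ioo a b) :
    derivWithin g (Set.Icc a b) s = deriv g s :=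
  derivWithin_of_mem_nhds (Icc_mem_nhds hs.1 hs.2)

theorem strictMonoOn_Icc_of_derivWithin_pos {a b : ℝ}
    (hφ : DifferentiableOn ℝ φ (Set.Icc a b))
    (hincr : ∀ s ∈ Set.Icc a b, 0 < derivWithin φ (Set.Icc a b) s) :
    StrictMonoOn φ (Set.Icc a b) := by
  refine strictMonoOn_of_deriv_pos (convex_Icc _ _) hφ.continuousOn fun s hs => ?_
  rw [interior_Icc] at hs
  rw [← derivWithin_Icc_eq_deriv_of_mem_Ioo φ hs]
  exact hincr s (Set.Ioo_subset_Icc_self hs)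

/-- The second derivative test needs only interior points; comparing slopes with the one-sided
derivative then carries the tangent inequality to the end points. -/
theorem tangent_le_of_derivWithin2_nonneg {a b : ℝ}
    (hφ : DifferentiableOn ℝ φ (Set.Icc a b))
    (hφ' : DifferentiableOn ℝ (derivWithin φ (Set.Icc a b)) (Set.Icc a b))
    (hconv : ∀ s ∈ Set.Icc a b,
      0 ≤ derivWithin (derivWithin φ (Set.Icc a b)) (Set.Icc a b) s)
    {s t : ℝ} (hs : s ∈ Set.Icc a b) (ht : t ∈ Set.Icc a b) :
    φ s + derivWithin φ (Set.Icc a b) s * (t - s) ≤ φ t := by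
  have hcv : ConvexOn ℝ (Set.Icc a b) φ := by
    refine convexOn_of_hasDerivWithinAt2_nonneg (f' := derivWithin φ (Set.Icc a b))
      (f'' := derivWithin (derivWithin φ (Set.Icc a b)) (Set.Icc a b))
      (convex_Icc _ _) hφ.continuousOn ?_ ?_ ?_
    · intro x hx
      exact (hφ x (interior_subset hx)).hasDerivWithinAt.mono interior_subset
    · intro x hx
      exact (hφ' x (interior_subset hx)).hasDerivWithinAt.mono interior_subset
    · intro x hx
      exact hconv x (interior_subset hx)
  rcases lt_trichotomy s t with h | rfl | h
  · have := hcv.le_slope_of_hasDerivWithinAt hs ht h (hφ s hs).hasDerivWithinAt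
    rw [slope_def_field, le_div_iff₀ (by linarith)] at this
    linarith
  · simp
  · have := hcv.slope_le_of_hasDerivWithinAt ht hs h (hφ s hs).hasDerivWithinAt
    rw [slope_def_field, div_le_iff₀ (by linarith)] at this
    linarith

end Convexity

/-- The sum over both time directions of the relative gains `1 - 1 / (D_x D_y)` of a hyperbolic
flow is bounded below to second order in `S`. -/
theorem two_sided_gain_lower_bound {a b C S : ℝ} (ha : |a| ≤ 1) (hb : |b| ≤ 1)
    (hC : 0 < C) (hCS : C ^ 2 = 1 + S ^ 2) (hS : S ^ 2 ≤ 1) :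
    2 * (S ^ 2 * (1 - a ^ 2 - b ^ 2 - a * b) - 3 * (S ^ 2) ^ 2) ≤
      (1 - 1 / ((C + a * S) * (C + b * S))) + (1 - 1 / ((C - a * S) * (C - b * S))) := by
  have key : ∀ u : ℝ, |u| ≤ 1 → 0 < C + u * S ∧ 0 < C - u * S := by
    intro u hu
    have h1 : |u * S| < C := by
      apply abs_lt_of_sq_lt_sq _ hC.le
      have : u ^ 2 ≤ 1 := by rwa [sq_le_one_iff_abs_le_one]
      nlinarith [sq_nonneg S]
    have := abs_lt.1 h1
    constructor <;> linarith
  obtain ⟨pa, ma⟩ := key a ha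
  obtain ⟨pb, mb⟩ := key b hb
  have ha2 : a ^ 2 ≤ 1 := by rwa [sq_le_one_iff_abs_le_one]
  have hb2 : b ^ 2 ≤ 1 := by rwa [sq_le_one_iff_abs_le_one]
  set σ := S ^ 2 with hσ
  have hσ0 : 0 ≤ σ := sq_nonneg S
  set α := 1 - a ^ 2 with hα
  set β := 1 - b ^ 2 with hβ
  have hα0 : 0 ≤ α := by linarith
  have hβ0 : 0 ≤ β := by linarith
  have hα1 : α ≤ 1 := by nlinarith [sq_nonneg a]
  have hβ1 : β ≤ 1 := by nlinarith [sq_nonneg b]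
  have hαβ0 : 0 ≤ α * β := mul_nonneg hα0 hβ0
  have hαβ1 : α * β ≤ 1 := mul_le_one₀ hα1 hβ0 hβ1
  set κ := 1 - a ^ 2 - b ^ 2 - a * b with hκ
  have hκ1 : κ ≤ 1 := by nlinarith [sq_nonneg (a + b), sq_nonneg a, sq_nonneg b]
  -- `N` is the product of all four factors: each pair gives `C² - a² S² = 1 + σ α`, and likewise
  -- with `β`.
  set N := 1 + σ * (α + β) + σ ^ 2 * (α * β) with hN
  have hN1 : 1 ≤ N := by
    have := mul_nonneg hσ0 (add_nonneg hα0 hβ0)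
    have := mul_nonneg (sq_nonneg σ) hαβ0
    linarith
  have hN3 : N - 1 ≤ 3 * σ := by
    have h1 : σ * (α + β) ≤ σ * 2 := mul_le_mul_of_nonneg_left (by linarith) hσ0
    have h2 : σ ^ 2 * (α * β) ≤ σ := by
      calc σ ^ 2 * (α * β) ≤ σ ^ 2 * 1 := mul_le_mul_of_nonneg_left hαβ1 (sq_nonneg σ)
        _ ≤ σ := by nlinarith
    linarith
  have hfac : (C + a * S) * (C + b * S) * ((C - a * S) * (C - b * S)) = N := by
    have : (C + a * S) * (C + b * S) * ((C - a * S) * (C - b * S))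
      = (C ^ 2 - a ^ 2 * S ^ 2) * (C ^ 2 - b ^ 2 * S ^ 2) := by ring
    rw [this, hCS, ← hσ, hN, hα, hβ]; ring
  have hsum : (1 - 1 / ((C + a * S) * (C + b * S))) + (1 - 1 / ((C - a * S) * (C - b * S)))
      = 2 * (1 - (1 + σ + a * b * σ) / N) := by
    have : 1 / ((C + a * S) * (C + b * S)) + 1 / ((C - a * S) * (C - b * S))
        = 2 * (1 + σ + a * b * σ) / N := by
      rw [← hfac, div_add_div _ _ (by positivity) (by positivity)]
      congr 1
      rw [hσ]
      linear_combination 2 * hCS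
    linear_combination -this
  rw [hsum]
  -- The exact gain is `(σ κ + σ² α β) / N`. Replacing `N` by `1` costs at most `3 σ²`, because `κ
  -- (N - 1) ≤ 3 σ`.
  have hmain : (1 + σ + a * b * σ) / N ≤ 1 - σ * κ + 3 * σ ^ 2 := by
    rw [div_le_iff₀ (by linarith)]
    have h1 : κ * (N - 1) ≤ 3 * σ := by
      calc κ * (N - 1) ≤ 1 * (N - 1) := mul_le_mul_of_nonneg_right hκ1 (by linarith)
        _ ≤ 3 * σ := by linarith
    have h2 : σ * (κ * (N - 1)) ≤ σ * (3 * σ) := mul_le_mul_of_nonneg_left h1 hσ0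
    have h3 : 3 * σ ^ 2 * 1 ≤ 3 * σ ^ 2 * N := mul_le_mul_of_nonneg_left hN1 (by positivity)
    have h4 : 0 ≤ σ ^ 2 * (α * β) := by positivity
    have h5 : N - (1 + σ + a * b * σ) = σ * κ + σ ^ 2 * (α * β) := by
      rw [hN, hκ]; simp only [hα, hβ]; ring
    nlinarith
  linarith

/-! ### The conformal flow and its effect on the pairing -/

section Flow

variable {E : Type*} [NormedAddCommGroup E] [InnerProductSpace ℝ E]

local notation "⟪" x ", " y "⟫" => inner ℝ x y

/-- The conformal flow of the unit sphere in the direction `v`, i.e. the flow of the vector field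
`x ↦ v - ⟨x, v⟩ x`, parametrized by the hyperbolic sine `S` of the time. -/
noncomputable def conformalFlow (v : E) (S : ℝ) (x : E) : E :=
  (√(1 + S ^ 2) + ⟪x, v⟫ * S)⁻¹ • (x + (S + (√(1 + S ^ 2) - 1) * ⟪x, v⟫) • v)

theorem sqrt_one_add_sq_add_mul_pos {a S : ℝ} (ha : |a| ≤ 1) : 0 < √(1 + S ^ 2) + a * S := by
  have h1 : |a * S| < √(1 + S ^ 2) := by
    apply Real.lt_sqrt_of_sq_lt
    rw [sq_abs, mul_pow]
    have : a ^ 2 ≤ 1 := by rwa [sq_le_one_iff_abs_le_one]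
    nlinarith [sq_nonneg S]
  linarith [(abs_lt.1 h1).1]

theorem abs_inner_le_one {x v : E} (hx : ‖x‖ = 1) (hv : ‖v‖ = 1) : |⟪x, v⟫| ≤ 1 := by
  simpa [hx, hv] using abs_real_inner_le_norm x v

theorem norm_conformalFlow {v x : E} (hv : ‖v‖ = 1) (hx : ‖x‖ = 1) (S : ℝ) :
    ‖conformalFlow v S x‖ = 1 := by
  have hD := sqrt_one_add_sq_add_mul_pos (S := S) (abs_inner_le_one hx hv)
  have hC : √(1 + S ^ 2) ^ 2 = 1 + S ^ 2 := Real.sq_sqrt (by positivity)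
  rw [conformalFlow, norm_smul, norm_inv, Real.norm_of_nonneg hD.le, inv_mul_eq_one₀ hD.ne',
    ← sq_eq_sq₀ hD.le (norm_nonneg _), norm_add_sq_real, inner_smul_right, norm_smul, hx, hv,
    mul_one, Real.norm_eq_abs, sq_abs]
  generalize √(1 + S ^ 2) = C at *
  linear_combination (1 - ⟪x, v⟫ ^ 2) * hC

/-- Boost invariance of `lam * x₀ * y₀ - ⟨T x, y⟩`: symmetry and `T v = lam • v` make the `v`
component split off with the same coefficient `lam` as the time component. -/
theorem sub_inner_conformalFlow {T : E →ₗ[ℝ] E} (hT : T.IsSymmetric) {lam : ℝ} {v x y : E}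
    (hTv : T v = lam • v) (hv : ‖v‖ = 1) (hx : ‖x‖ = 1) (hy : ‖y‖ = 1) (S : ℝ) :
    lam - ⟪T (conformalFlow v S x), conformalFlow v S y⟫ =
      (lam - ⟪T x, y⟫) *
        (1 / ((√(1 + S ^ 2) + ⟪x, v⟫ * S) * (√(1 + S ^ 2) + ⟪y, v⟫ * S))) := by
  have hDx := sqrt_one_add_sq_add_mul_pos (S := S) (abs_inner_le_one hx hv)
  have hDy := sqrt_one_add_sq_add_mul_pos (S := S) (abs_inner_le_one hy hv)
  have hC : √(1 + S ^ 2) ^ 2 = 1 + S ^ 2 := Real.sq_sqrt (by positivity)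
  have h1 : ⟪T x, v⟫ = lam * ⟪x, v⟫ := by rw [hT x v, hTv, inner_smul_right]
  have h2 : ⟪v, y⟫ = ⟪y, v⟫ := real_inner_comm _ _
  have h3 : ⟪v, v⟫ = 1 := by rw [real_inner_self_eq_norm_sq, hv]; norm_num
  simp only [conformalFlow, map_smul, map_add, hTv, inner_smul_left, inner_smul_right,
    inner_add_left, inner_add_right, h1, h2, h3, RCLike.conj_to_real]
  generalize √(1 + S ^ 2) = C at *
  generalize ⟪x, v⟫ = a at *
  generalize ⟪y, v⟫ = b at *
  have hDx' := hDx.ne'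
  have hDy' := hDy.ne'
  rw [one_div, mul_inv]
  have ex : (C + a * S)⁻¹ * (C + a * S) = 1 := inv_mul_cancel₀ hDx'
  have ey : (C + b * S)⁻¹ * (C + b * S) = 1 := inv_mul_cancel₀ hDy'
  generalize (C + a * S)⁻¹ = p at *
  generalize (C + b * S)⁻¹ = q at *
  linear_combination -lam * ex * q * (C + b * S) - lam * ey + p * q * lam * (1 - a * b) * hC

/-- The bound depends on neither `x` nor `v` and tends to `0` with `S`, which is what Wasserstein
closeness requires. -/
theorem norm_conformalFlow_sub_le {v x : E} (hv : ‖v‖ = 1) (hx : ‖x‖ = 1) (S : ℝ) :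
    ‖conformalFlow v S x - x‖ ≤
      2 * (|S| + |√(1 + S ^ 2) - 1|) / (√(1 + S ^ 2) - |S|) := by
  have ha := abs_inner_le_one hx hv
  have hD := sqrt_one_add_sq_add_mul_pos (S := S) ha
  have hD0 : 0 < √(1 + S ^ 2) - |S| := by
    have : |S| < √(1 + S ^ 2) := by
      apply Real.lt_sqrt_of_sq_lt
      rw [sq_abs]; linarith
    linarith
  have haS : |⟪x, v⟫ * S| ≤ |S| := by
    rw [abs_mul]; exact mul_le_of_le_one_left (abs_nonneg _) ha
  have hle : √(1 + S ^ 2) - |S| ≤ √(1 + S ^ 2) + ⟪x, v⟫ * S := by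
    linarith [(abs_le.1 haS).1]
  have heq : conformalFlow v S x - x = (√(1 + S ^ 2) + ⟪x, v⟫ * S)⁻¹ •
      ((S + (√(1 + S ^ 2) - 1) * ⟪x, v⟫) • v - (√(1 + S ^ 2) - 1 + ⟪x, v⟫ * S) • x) := by
    rw [eq_inv_smul_iff₀ hD.ne', smul_sub, conformalFlow, smul_inv_smul₀ hD.ne']
    module
  rw [heq, norm_smul, norm_inv, Real.norm_of_nonneg hD.le, inv_mul_eq_div]
  refine div_le_div₀ (by positivity) ?_ hD0 hle
  refine (norm_sub_le _ _).trans ?_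
  rw [norm_smul, norm_smul, hv, hx, mul_one, mul_one, Real.norm_eq_abs, Real.norm_eq_abs]
  have h1 : |(√(1 + S ^ 2) - 1) * ⟪x, v⟫| ≤ |√(1 + S ^ 2) - 1| := by
    rw [abs_mul]; exact mul_le_of_le_one_right (abs_nonneg _) ha
  have h2 := abs_add_le S ((√(1 + S ^ 2) - 1) * ⟪x, v⟫)
  have h3 := abs_add_le (√(1 + S ^ 2) - 1) (⟪x, v⟫ * S)
  linarith

end Flow

/-! ### Norm bound and eigenvectors from the sorted eigenvalues -/

section Spectral

variable {d : ℕ} {A : Matrix (Fin d) (Fin d) ℝ}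

theorem norm_mulVecE_le (hA : A.IsSymm) {lam : ℝ} (hlam : 0 ≤ lam)
    (hle : ∀ i, |sortedEigenvalue hA i| ≤ lam) (x : EuclideanSpace ℝ (Fin d)) :
    ‖mulVecE A x‖ ≤ lam * ‖x‖ := by
  set b := (symmOperator hA).eigenvectorBasis finrank_euclideanSpace_fin with hb
  rw [← sq_le_sq₀ (norm_nonneg _) (by positivity), mul_pow, ← b.sum_sq_norm_inner_right,
    ← b.sum_sq_norm_inner_right x, Finset.mul_sum]
  refine Finset.sum_le_sum fun i _ => ?_
  have h : inner ℝ (b i) (mulVecE A x) = sortedEigenvalue hA i * inner ℝ (b i) x := by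
    rw [← symmOperator hA, (symmOperator hA).apply_eigenvectorBasis, inner_smul_left]
    rfl
  rw [h, norm_mul, mul_pow]
  refine mul_le_mul_of_nonneg_right ?_ (sq_nonneg _)
  exact pow_le_pow_left₀ (norm_nonneg _) (hle i) 2

theorem abs_sortedEigenvalue_le (hA : A.IsSymm) {lam : ℝ} {i j : Fin d}
    (hi : ∀ k, i ≤ k) (hj : ∀ k, k ≤ j) (h1 : sortedEigenvalue hA i = lam)
    (h2 : |sortedEigenvalue hA j| ≤ lam) (k : Fin d) : |sortedEigenvalue hA k| ≤ lam := by
  have hanti := (symmOperator hA).eigenvalues_antitone finrank_euclideanSpace_fin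
  have h3 : sortedEigenvalue hA k ≤ sortedEigenvalue hA i := hanti (hi k)
  have h4 : sortedEigenvalue hA j ≤ sortedEigenvalue hA k := hanti (hj k)
  rw [abs_le] at *
  constructor <;> linarith

theorem exists_orthonormal_eigenvectors (hA : A.IsSymm) {lam : ℝ} {ι : Type*} {f : ι → Fin d}
    (hf : Function.Injective f) (h : ∀ i, sortedEigenvalue hA (f i) = lam) :
    ∃ v : ι → EuclideanSpace ℝ (Fin d), Orthonormal ℝ v ∧ ∀ i, mulVecE A (v i) = lam • v i := by
  refine ⟨fun i => (symmOperator hA).eigenvectorBasis finrank_euclideanSpace_fin (f i),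
    ((symmOperator hA).eigenvectorBasis _).orthonormal.comp f hf, fun i => ?_⟩
  rw [mulVecE, (symmOperator hA).apply_eigenvectorBasis, ← h i]
  rfl

end Spectral

/-! ### Positivity of the traced second variation -/

section InnerProduct

variable {E : Type*} [NormedAddCommGroup E] [InnerProductSpace ℝ E]

local notation "⟪" x ", " y "⟫" => inner ℝ x y

theorem inner_mem_Icc {T : E →ₗ[ℝ] E} {lam : ℝ} (hT : ∀ x, ‖T x‖ ≤ lam * ‖x‖) {x y : E}
    (hx : ‖x‖ = 1) (hy : ‖y‖ = 1) : ⟪T x, y⟫ ∈ Set.Icc (-lam) lam := by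
  rw [Set.mem_Icc, ← abs_le]
  have := abs_real_inner_le_norm (T x) y
  have := hT x
  simp only [hx, hy, mul_one] at *
  linarith

/-- The equality case of Cauchy–Schwarz. -/
theorem apply_eq_smul_of_inner_eq {T : E →ₗ[ℝ] E} {lam : ℝ} (hT : ∀ x, ‖T x‖ ≤ lam * ‖x‖)
    {x y : E} (hx : ‖x‖ = 1) (hy : ‖y‖ = 1) (h : ⟪T x, y⟫ = lam) : T x = lam • y := by
  have h1 : ‖T x‖ ≤ lam := by simpa [hx] using hT x
  have h2 : ‖T x - lam • y‖ ^ 2 ≤ 0 := by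
    rw [norm_sub_sq_real, inner_smul_right, norm_smul, h, hy, mul_one, Real.norm_eq_abs, sq_abs]
    nlinarith [norm_nonneg (T x)]
  have h3 : ‖T x - lam • y‖ = 0 := by
    have := norm_nonneg (T x - lam • y)
    nlinarith
  exact sub_eq_zero.1 (norm_eq_zero.1 h3)

/-- The trace over a finite family of directions of the second variation coefficient of the
conformal flows. -/
noncomputable def conformalHessian {ι : Type*} [Fintype ι] (v : ι → E) (x y : E) : ℝ :=
  ∑ i, (1 - ⟪x, v i⟫ ^ 2 - ⟪y, v i⟫ ^ 2 - ⟪x, v i⟫ * ⟪y, v i⟫)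

variable {ι : Type*} [Fintype ι] {v : ι → E}

theorem sum_sq_inner_le_one (hv : Orthonormal ℝ v) {x : E} (hx : ‖x‖ = 1) :
    ∑ i, ⟪x, v i⟫ ^ 2 ≤ 1 := by
  have := hv.sum_inner_products_le x (s := Finset.univ)
  simpa [hx, real_inner_comm] using this

/-- This is where three directions matter: with `k` of them the trace at `x = y` in the span would
be `k - 3`. -/
theorem conformalHessian_eq (hι : Fintype.card ι = 3) (x y : E) :
    conformalHessian v x y = 3 / 2 * (1 - ∑ i, ⟪x, v i⟫ ^ 2) + 3 / 2 * (1 - ∑ i, ⟪y, v i⟫ ^ 2)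
      + 1 / 2 * ∑ i, (⟪x, v i⟫ - ⟪y, v i⟫) ^ 2 := by
  have : ∑ _i : ι, (1 : ℝ) = 3 := by simp [hι]
  rw [conformalHessian, ← sub_eq_zero]
  simp only [sub_sq, Finset.sum_add_distrib, Finset.sum_sub_distrib, mul_assoc,
    ← Finset.mul_sum, this]
  ring

theorem conformalHessian_nonneg (hι : Fintype.card ι = 3) (hv : Orthonormal ℝ v) {x y : E}
    (hx : ‖x‖ = 1) (hy : ‖y‖ = 1) : 0 ≤ conformalHessian v x y := by
  rw [conformalHessian_eq hι]
  have h1 := sum_sq_inner_le_one hv hx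
  have h2 := sum_sq_inner_le_one hv hy
  have h3 : 0 ≤ ∑ i, (⟪x, v i⟫ - ⟪y, v i⟫) ^ 2 := Finset.sum_nonneg fun i _ => sq_nonneg _
  linarith

theorem eq_sum_of_sum_sq_inner_eq_one (hv : Orthonormal ℝ v) {x : E} (hx : ‖x‖ = 1)
    (h : ∑ i, ⟪x, v i⟫ ^ 2 = 1) : x = ∑ i, ⟪x, v i⟫ • v i := by
  have h1 : ‖x - ∑ i, ⟪x, v i⟫ • v i‖ ^ 2 = 0 := by
    rw [norm_sub_sq_real, ← real_inner_self_eq_norm_sq (∑ i, ⟪x, v i⟫ • v i),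
      hv.inner_sum, inner_sum, hx]
    simp only [inner_smul_right, RCLike.conj_to_real, ← sq, h]
    norm_num
  exact sub_eq_zero.1 (norm_eq_zero.1 (pow_eq_zero_iff two_ne_zero |>.1 h1))

/-- All three nonnegative terms vanish, so both points lie in the span of the `v i` with equal
coordinates: they are one and the same eigenvector. -/
theorem inner_eq_of_conformalHessian_eq_zero {T : E →ₗ[ℝ] E} {lam : ℝ}
    (hι : Fintype.card ι = 3) (hv : Orthonormal ℝ v) (hTv : ∀ i, T (v i) = lam • v i) {x y : E}
    (hx : ‖x‖ = 1) (hy : ‖y‖ = 1) (h : conformalHessian v x y = 0) : ⟪T x, y⟫ = lam := by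
  rw [conformalHessian_eq hι] at h
  have h1 := sum_sq_inner_le_one hv hx
  have h2 := sum_sq_inner_le_one hv hy
  have h3 : 0 ≤ ∑ i, (⟪x, v i⟫ - ⟪y, v i⟫) ^ 2 := Finset.sum_nonneg fun i _ => sq_nonneg _
  have h4 : ∑ i, (⟪x, v i⟫ - ⟪y, v i⟫) ^ 2 = 0 := by linarith
  have h5 : ∀ i, ⟪x, v i⟫ = ⟪y, v i⟫ := fun i => by
    have := (Finset.sum_eq_zero_iff_of_nonneg fun i _ => sq_nonneg _).1 h4 i (Finset.mem_univ i)
    exact sub_eq_zero.1 (pow_eq_zero_iff two_ne_zero |>.1 this)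
  have hx' := eq_sum_of_sum_sq_inner_eq_one hv hx (by linarith)
  have hy' := eq_sum_of_sum_sq_inner_eq_one hv hy (by linarith)
  have hxy : x = y := by
    rw [hx', hy']
    simp only [h5]
  have hTx : T x = lam • x := by
    conv_lhs => rw [hx']
    conv_rhs => rw [hx']
    simp only [map_sum, map_smul, hTv, Finset.smul_sum, smul_comm lam]
  rw [hTx, ← hxy, inner_smul_left, real_inner_self_eq_norm_sq, hx]
  simp

end InnerProduct
open scoped ENNReal

/-! ### Wasserstein distance to a pushforward -/

section Wasserstein

variable {X : Type*} [MeasurableSpace X] [PseudoEMetricSpace X] [OpensMeasurableSpace X]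
  [SecondCountableTopology X]

/-- The graph of `T` carries a coupling of cost at most `r²`. -/
theorem wasserstein2_map_le (μ : ProbabilityMeasure X) {T : X → X} (hT : Measurable T) {r : ℝ≥0∞}
    (hr : ∀ x, edist x (T x) ≤ r) :
    wasserstein2 μ (μ.map hT.aemeasurable) ≤ r := by
  have hm : Measurable fun x => (x, T x) := measurable_id.prodMk hT
  have hγ : (μ : Measure X).map (fun x => (x, T x)) ∈ couplings μ (μ.map hT.aemeasurable) := by
    constructor
    · rw [Measure.map_map measurable_fst hm]
      exact Measure.map_id
    · rw [Measure.map_map measurable_snd hm]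
      rfl
  have h1 : ∫⁻ p, edist p.1 p.2 ^ 2 ∂((μ : Measure X).map fun x => (x, T x)) ≤ r ^ 2 := by
    rw [lintegral_map (by fun_prop) hm]
    calc ∫⁻ x, edist x (T x) ^ 2 ∂(μ : Measure X) ≤ ∫⁻ _, r ^ 2 ∂(μ : Measure X) :=
          lintegral_mono fun x => by gcongr; exact hr x
      _ = r ^ 2 := by simp
  calc wasserstein2 μ (μ.map hT.aemeasurable) ≤ (r ^ 2) ^ (1 / 2 : ℝ) := by
        unfold wasserstein2
        gcongr
        exact (iInf₂_le _ hγ).trans h1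
    _ = r := by
        rw [← ENNReal.rpow_natCast, ← ENNReal.rpow_mul]
        norm_num

end Wasserstein

theorem eq_dirac_of_ae_eq {X : Type*} [MeasurableSpace X] {μ : Measure X} [IsProbabilityMeasure μ]
    {x₀ : X} (h : ∀ᵐ x ∂μ, x = x₀) : μ = Measure.dirac x₀ := by
  calc μ = μ.map id := Measure.map_id.symm
    _ = μ.map (fun _ => x₀) := Measure.map_congr h
    _ = Measure.dirac x₀ := by rw [Measure.map_const, measure_univ, one_smul]

/-! ### The energy on the sphere and its maximizers -/

section Sphere

variable {d : ℕ}

theorem norm_unitSphere (x : UnitSphere d) : ‖(x : EuclideanSpace ℝ (Fin d))‖ = 1 :=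
  norm_eq_of_mem_sphere x

/-- The conformal flow as a self-map of the unit sphere. -/
noncomputable def sphereFlow (v : UnitSphere d) (S : ℝ) (x : UnitSphere d) : UnitSphere d :=
  ⟨conformalFlow (v : EuclideanSpace ℝ (Fin d)) S x, by
    rw [mem_sphere_zero_iff_norm]
    exact norm_conformalFlow (norm_unitSphere v) (norm_unitSphere x) S⟩

theorem continuous_sphereFlow (v : UnitSphere d) (S : ℝ) : Continuous (sphereFlow v S) := by
  refine Continuous.subtype_mk ?_ _
  unfold conformalFlow
  have hin : Continuous fun x : UnitSphere d =>
      inner ℝ (x : EuclideanSpace ℝ (Fin d)) (v : EuclideanSpace ℝ (Fin d)) := by fun_prop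
  refine ((continuous_const.add (hin.mul continuous_const)).inv₀ fun x => ?_).smul
    (continuous_subtype_val.add
      ((continuous_const.add (continuous_const.mul hin)).smul continuous_const))
  exact (sqrt_one_add_sq_add_mul_pos
    (abs_inner_le_one (norm_unitSphere x) (norm_unitSphere v))).ne'

theorem eventually_wasserstein2_sphereFlow_lt (μ : ProbabilityMeasure (UnitSphere d)) {ε : ℝ≥0∞}
    (hε : 0 < ε) : ∀ᶠ S : ℝ in nhds 0, ∀ v : UnitSphere d,
      wasserstein2 μ (μ.map (continuous_sphereFlow v S).measurable.aemeasurable) < ε := by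
  have hcont : ContinuousAt
      (fun S : ℝ => 2 * (|S| + |√(1 + S ^ 2) - 1|) / (√(1 + S ^ 2) - |S|)) 0 := by
    refine ContinuousAt.div (by fun_prop) (by fun_prop) (by simp)
  have hlim := (ENNReal.continuous_ofReal.continuousAt.comp hcont).tendsto
  have h0 : (ENNReal.ofReal ∘ fun S : ℝ =>
      2 * (|S| + |√(1 + S ^ 2) - 1|) / (√(1 + S ^ 2) - |S|)) 0 < ε := by simpa using hε
  filter_upwards [hlim.eventually_lt_const h0] with S hS v
  refine (wasserstein2_map_le μ (continuous_sphereFlow v S).measurable fun x => ?_).trans_lt hS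
  rw [edist_dist, dist_comm, Subtype.dist_eq, dist_eq_norm]
  exact ENNReal.ofReal_le_ofReal
    (norm_conformalFlow_sub_le (norm_unitSphere v) (norm_unitSphere x) S)

/-- The pairing `⟨A x, y⟩` of two points of the sphere. -/
noncomputable def spherePairing (A : Matrix (Fin d) (Fin d) ℝ) (p : UnitSphere d × UnitSphere d) :
    ℝ :=
  inner ℝ (mulVecE A (p.1 : EuclideanSpace ℝ (Fin d))) (p.2 : EuclideanSpace ℝ (Fin d))

theorem continuous_spherePairing (A : Matrix (Fin d) (Fin d) ℝ) :
    Continuous (spherePairing A) := by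
  have h : Continuous (Matrix.toEuclideanLin A) := LinearMap.continuous_of_finiteDimensional _
  exact (h.comp (continuous_subtype_val.comp continuous_fst)).inner
    (continuous_subtype_val.comp continuous_snd)

theorem integrable_of_continuous {X : Type*} [TopologicalSpace X] [CompactSpace X]
    [MeasurableSpace X] [OpensMeasurableSpace X] {μ : Measure X} [IsFiniteMeasure μ] {f : X → ℝ}
    (hf : Continuous f) : Integrable f μ :=
  hf.integrable_of_hasCompactSupport (HasCompactSupport.of_compactSpace f)

variable {A : Matrix (Fin d) (Fin d) ℝ} {φ : ℝ → ℝ}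

theorem interactionEnergy_eq_integral_prod (hφ : Continuous fun p => φ (spherePairing A p))
    (μ : ProbabilityMeasure (UnitSphere d)) :
    interactionEnergy A φ μ = 1 / 2 * ∫ p, φ (spherePairing A p)
      ∂((μ : Measure (UnitSphere d)).prod (μ : Measure (UnitSphere d))) := by
  rw [integral_prod _ (integrable_of_continuous hφ)]
  rfl

theorem interactionEnergy_map (hφ : Continuous fun p => φ (spherePairing A p))
    (μ : ProbabilityMeasure (UnitSphere d)) {T : UnitSphere d → UnitSphere d}
    (hT : Continuous T) :
    interactionEnergy A φ (μ.map hT.measurable.aemeasurable) =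
      1 / 2 * ∫ p, φ (spherePairing A (T p.1, T p.2))
        ∂((μ : Measure (UnitSphere d)).prod (μ : Measure (UnitSphere d))) := by
  rw [interactionEnergy_eq_integral_prod hφ, ProbabilityMeasure.toMeasure_map,
    Measure.map_prod_map _ _ hT.measurable hT.measurable,
    integral_map (hT.measurable.prodMap hT.measurable).aemeasurable
      hφ.aestronglyMeasurable]
  rfl

variable {lam : ℝ}

theorem interactionEnergy_eq_of_ae_eq (hφ : Continuous fun p => φ (spherePairing A p))
    {μ : ProbabilityMeasure (UnitSphere d)}
    (h : ∀ᵐ p ∂((μ : Measure (UnitSphere d)).prod (μ : Measure (UnitSphere d))),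
      spherePairing A p = lam) :
    interactionEnergy A φ μ = 1 / 2 * φ lam := by
  rw [interactionEnergy_eq_integral_prod hφ, integral_congr_ae (g := fun _ => φ lam)]
  · simp
  · filter_upwards [h] with p hp
    rw [hp]

theorem interactionEnergy_le (hφ : Continuous fun p => φ (spherePairing A p))
    (hle : ∀ p, φ (spherePairing A p) ≤ φ lam) (μ : ProbabilityMeasure (UnitSphere d)) :
    interactionEnergy A φ μ ≤ 1 / 2 * φ lam := by
  rw [interactionEnergy_eq_integral_prod hφ]
  have := integral_mono (μ := (μ : Measure (UnitSphere d)).prod (μ : Measure (UnitSphere d)))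
    (integrable_of_continuous hφ) (integrable_const (φ lam)) hle
  simp only [integral_const, probReal_univ, one_smul] at this
  linarith

theorem ae_eq_of_le_interactionEnergy (hφ : Continuous fun p => φ (spherePairing A p))
    (hle : ∀ p, φ (spherePairing A p) ≤ φ lam)
    (hinj : ∀ p, φ (spherePairing A p) = φ lam → spherePairing A p = lam)
    {μ : ProbabilityMeasure (UnitSphere d)} (h : 1 / 2 * φ lam ≤ interactionEnergy A φ μ) :
    ∀ᵐ p ∂((μ : Measure (UnitSphere d)).prod (μ : Measure (UnitSphere d))),
      spherePairing A p = lam := by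
  rw [interactionEnergy_eq_integral_prod hφ] at h
  set π := (μ : Measure (UnitSphere d)).prod (μ : Measure (UnitSphere d))
  have hi : Integrable (fun p => φ (spherePairing A p)) π := integrable_of_continuous hφ
  have h1 : ∫ p, (φ lam - φ (spherePairing A p)) ∂π = 0 := by
    apply le_antisymm
    · rw [integral_sub (integrable_const _) hi]
      simp only [integral_const, probReal_univ, one_smul]
      linarith
    · exact integral_nonneg fun p => sub_nonneg.2 (hle p)
  rw [integral_eq_zero_iff_of_nonneg (fun p => sub_nonneg.2 (hle p))
    ((integrable_const _).sub hi)] at h1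
  filter_upwards [h1] with p hp
  exact hinj p (sub_eq_zero.1 hp).symm

/-- A probability measure concentrated on pairs with maximal pairing is a point mass at an
eigenvector. -/
theorem exists_eq_dirac_of_ae_pairing_eq (hlam : 0 < lam)
    (hA : ∀ x, ‖mulVecE A x‖ ≤ lam * ‖x‖) {μ : ProbabilityMeasure (UnitSphere d)}
    (h : ∀ᵐ p ∂((μ : Measure (UnitSphere d)).prod (μ : Measure (UnitSphere d))),
      spherePairing A p = lam) :
    ∃ x₀ : UnitSphere d,
      mulVecE A (x₀ : EuclideanSpace ℝ (Fin d)) = lam • (x₀ : EuclideanSpace ℝ (Fin d)) ∧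
      (μ : Measure (UnitSphere d)) = Measure.dirac x₀ := by
  have hsmul : ∀ x y : UnitSphere d, spherePairing A (x, y) = lam →
      mulVecE A (x : EuclideanSpace ℝ (Fin d)) = lam • (y : EuclideanSpace ℝ (Fin d)) :=
    fun x y hxy => apply_eq_smul_of_inner_eq hA (norm_unitSphere x) (norm_unitSphere y) hxy
  have h' := Measure.ae_ae_of_ae_prod h
  obtain ⟨x, hx⟩ := h'.exists
  obtain ⟨x₀, hx₀⟩ := hx.exists
  -- For the fixed `x`, almost every `y` solves `A x = lam • y`, which determines `y`.
  have hae : ∀ᵐ y ∂(μ : Measure (UnitSphere d)), y = x₀ := by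
    filter_upwards [hx] with y hy
    have := (hsmul x y hy).symm.trans (hsmul x x₀ hx₀)
    exact Subtype.ext (smul_right_injective _ hlam.ne' this)
  have hdirac := eq_dirac_of_ae_eq hae
  refine ⟨x₀, ?_, hdirac⟩
  -- Both coordinates can be chosen equal to the atom, so the pairing condition holds on the
  -- diagonal there.
  obtain ⟨y, rfl, hy⟩ := (hae.and h').exists
  obtain ⟨z, rfl, hz⟩ := (hae.and hy).exists
  exact hsmul z z hz

end Sphere

/-! ### Second order test at a local maximum -/

section LocalMax

variable {d : ℕ} {A : Matrix (Fin d) (Fin d) ℝ} {φ ψ : ℝ → ℝ} {lam : ℝ}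
  {ι : Type*} [Fintype ι] {v : ι → UnitSphere d}

theorem continuous_conformalHessian (w : ι → EuclideanSpace ℝ (Fin d)) :
    Continuous fun p : UnitSphere d × UnitSphere d =>
      conformalHessian w (p.1 : EuclideanSpace ℝ (Fin d)) (p.2 : EuclideanSpace ℝ (Fin d)) := by
  unfold conformalHessian
  fun_prop

theorem spherePairing_mem_Icc (hA : ∀ x, ‖mulVecE A x‖ ≤ lam * ‖x‖)
    (p : UnitSphere d × UnitSphere d) : spherePairing A p ∈ Set.Icc (-lam) lam :=
  inner_mem_Icc hA (norm_unitSphere _) (norm_unitSphere _)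

theorem comp_spherePairing_continuous {g : ℝ → ℝ} (hA : ∀ x, ‖mulVecE A x‖ ≤ lam * ‖x‖)
    (hg : ContinuousOn g (Set.Icc (-lam) lam)) : Continuous fun p => g (spherePairing A p) :=
  hg.comp_continuous (continuous_spherePairing A) (spherePairing_mem_Icc hA)

/-- Second order lower bound for the gain of the energy density along the conformal flows in
three orthogonal directions, forwards and backwards. -/
theorem sum_gain_sphereFlow_ge (hsymm : A.IsSymm) (hι : Fintype.card ι = 3)
    (hA : ∀ x, ‖mulVecE A x‖ ≤ lam * ‖x‖)
    (hv : ∀ i, mulVecE A (v i : EuclideanSpace ℝ (Fin d)) = lam • (v i : EuclideanSpace ℝ (Fin d)))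
    (hψ : ∀ s ∈ Set.Icc (-lam) lam, 0 ≤ ψ s)
    (htan : ∀ s ∈ Set.Icc (-lam) lam, ∀ t ∈ Set.Icc (-lam) lam, φ s + ψ s * (t - s) ≤ φ t)
    {S : ℝ} (hS : S ^ 2 ≤ 1) (p : UnitSphere d × UnitSphere d) :
    2 * (ψ (spherePairing A p) * (lam - spherePairing A p)) *
        (S ^ 2 * conformalHessian (fun i => (v i : EuclideanSpace ℝ (Fin d))) p.1 p.2
          - 9 * (S ^ 2) ^ 2) ≤
      ∑ i, ((φ (spherePairing A (sphereFlow (v i) S p.1, sphereFlow (v i) S p.2))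
          - φ (spherePairing A p)) +
        (φ (spherePairing A (sphereFlow (v i) (-S) p.1, sphereFlow (v i) (-S) p.2))
          - φ (spherePairing A p))) := by
  have hs := spherePairing_mem_Icc hA p
  set s := spherePairing A p with hsdef
  have hc : 0 ≤ ψ s * (lam - s) := mul_nonneg (hψ s hs) (by linarith [hs.2])
  have hgain : ∀ (i : ι) (S : ℝ), ψ s * (lam - s) *
      (1 - 1 / ((√(1 + S ^ 2) + inner ℝ (p.1 : EuclideanSpace ℝ (Fin d)) (v i : _) * S) *
        (√(1 + S ^ 2) + inner ℝ (p.2 : EuclideanSpace ℝ (Fin d)) (v i : _) * S))) ≤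
      φ (spherePairing A (sphereFlow (v i) S p.1, sphereFlow (v i) S p.2)) - φ s := by
    intro i S
    have h1 := htan s hs _
      (spherePairing_mem_Icc hA (sphereFlow (v i) S p.1, sphereFlow (v i) S p.2))
    have h2 : lam - spherePairing A (sphereFlow (v i) S p.1, sphereFlow (v i) S p.2) =
        (lam - s) * _ := sub_inner_conformalFlow (symmOperator hsymm) (hv i)
      (norm_unitSphere (v i)) (norm_unitSphere p.1) (norm_unitSphere p.2) S
    have h3 : spherePairing A (sphereFlow (v i) S p.1, sphereFlow (v i) S p.2) - s =
        (lam - s) - (lam - spherePairing A (sphereFlow (v i) S p.1, sphereFlow (v i) S p.2)) := by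
      ring
    rw [h3, h2] at h1
    linarith
  -- The constant `9` collects the error `3` from each of the three directions.
  have hsum : 2 * (S ^ 2 * conformalHessian (fun i => (v i : EuclideanSpace ℝ (Fin d))) p.1 p.2
      - 9 * (S ^ 2) ^ 2) = ∑ i, 2 * (S ^ 2 * (1 -
        inner ℝ (p.1 : EuclideanSpace ℝ (Fin d)) (v i : EuclideanSpace ℝ (Fin d)) ^ 2 -
        inner ℝ (p.2 : EuclideanSpace ℝ (Fin d)) (v i : EuclideanSpace ℝ (Fin d)) ^ 2 -
        inner ℝ (p.1 : EuclideanSpace ℝ (Fin d)) (v i : EuclideanSpace ℝ (Fin d)) *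
        inner ℝ (p.2 : EuclideanSpace ℝ (Fin d)) (v i : EuclideanSpace ℝ (Fin d))) -
          3 * (S ^ 2) ^ 2) := by
    rw [← Finset.mul_sum, Finset.sum_sub_distrib, ← Finset.mul_sum, Finset.sum_const,
      Finset.card_univ, hι, conformalHessian]
    simp only [nsmul_eq_mul, Nat.cast_ofNat]
    ring
  rw [mul_assoc, mul_left_comm, hsum, Finset.mul_sum]
  refine Finset.sum_le_sum fun i _ => ?_
  refine le_trans ?_ (add_le_add (hgain i S) (hgain i (-S)))
  rw [← mul_add]
  refine mul_le_mul_of_nonneg_left ?_ hc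
  have := two_sided_gain_lower_bound
    (abs_inner_le_one (norm_unitSphere p.1) (norm_unitSphere (v i)))
    (abs_inner_le_one (norm_unitSphere p.2) (norm_unitSphere (v i)))
    (C := √(1 + S ^ 2)) (by positivity) (Real.sq_sqrt (by positivity)) hS
  simpa only [neg_sq, mul_neg, ← sub_eq_add_neg] using this

theorem ae_pairing_eq_of_isWassersteinLocalMax (hsymm : A.IsSymm) (hι : Fintype.card ι = 3)
    (hA : ∀ x, ‖mulVecE A x‖ ≤ lam * ‖x‖)
    (horth : Orthonormal ℝ fun i => (v i : EuclideanSpace ℝ (Fin d)))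
    (hv : ∀ i, mulVecE A (v i : EuclideanSpace ℝ (Fin d)) = lam • (v i : EuclideanSpace ℝ (Fin d)))
    (hφ : ContinuousOn φ (Set.Icc (-lam) lam)) (hψc : ContinuousOn ψ (Set.Icc (-lam) lam))
    (hψ : ∀ s ∈ Set.Icc (-lam) lam, 0 < ψ s)
    (htan : ∀ s ∈ Set.Icc (-lam) lam, ∀ t ∈ Set.Icc (-lam) lam, φ s + ψ s * (t - s) ≤ φ t)
    {μ : ProbabilityMeasure (UnitSphere d)}
    (hμ : IsWassersteinLocalMax (interactionEnergy A φ) μ) :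
    ∀ᵐ p ∂((μ : Measure (UnitSphere d)).prod (μ : Measure (UnitSphere d))),
      spherePairing A p = lam := by
  obtain ⟨ε, hε, hmax⟩ := hμ
  set π := (μ : Measure (UnitSphere d)).prod (μ : Measure (UnitSphere d))
  have hφs := comp_spherePairing_continuous hA hφ
  have hφi : Integrable (fun p => φ (spherePairing A p)) π := integrable_of_continuous hφs
  set c : UnitSphere d × UnitSphere d → ℝ :=
    fun p => ψ (spherePairing A p) * (lam - spherePairing A p)
  have hc : Continuous c := (comp_spherePairing_continuous hA hψc).mul
    (continuous_const.sub (continuous_spherePairing A))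
  have hc0 : ∀ p, 0 ≤ c p := fun p => mul_nonneg (hψ _ (spherePairing_mem_Icc hA p)).le
    (by linarith [(spherePairing_mem_Icc hA p).2])
  set H : UnitSphere d × UnitSphere d → ℝ :=
    fun p => conformalHessian (fun i => (v i : EuclideanSpace ℝ (Fin d))) p.1 p.2
  have hH : Continuous H := continuous_conformalHessian _
  have hH0 : ∀ p, 0 ≤ H p := fun p =>
    conformalHessian_nonneg hι horth (norm_unitSphere p.1) (norm_unitSphere p.2)
  have hcH : Integrable (fun p => c p * H p) π := integrable_of_continuous (hc.mul hH)
  have hci : Integrable c π := integrable_of_continuous hc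
  have hflow : ∀ (i : ι) (S : ℝ), Continuous fun p : UnitSphere d × UnitSphere d =>
      φ (spherePairing A (sphereFlow (v i) S p.1, sphereFlow (v i) S p.2)) := fun i S =>
    hφs.comp (((continuous_sphereFlow (v i) S).comp continuous_fst).prodMk
      ((continuous_sphereFlow (v i) S).comp continuous_snd))
  -- The puncture at `0` allows division by `2 S²`; both `S` and `-S` must keep the pushforward
  -- within `ε` of `μ`.
  have hbound : ∀ᶠ S : ℝ in nhdsWithin 0 {0}ᶜ,
      ∫ p, c p * H p ∂π ≤ 9 * S ^ 2 * ∫ p, c p ∂π := by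
    have hW := eventually_wasserstein2_sphereFlow_lt μ hε
    have hWneg := (continuous_neg (G := ℝ)).continuousAt.tendsto (x := 0)
    rw [neg_zero] at hWneg
    have hone : ∀ᶠ S : ℝ in nhds 0, S ^ 2 < 1 :=
      ((continuous_pow 2).tendsto' (0 : ℝ) 0 (by simp)).eventually_lt_const one_pos
    filter_upwards [nhdsWithin_le_nhds hW, nhdsWithin_le_nhds (hWneg.eventually hW),
      nhdsWithin_le_nhds hone, self_mem_nhdsWithin] with S h1 h2 h3 h4
    have hle : ∀ (i : ι) (S : ℝ), wasserstein2 μ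
        (μ.map (continuous_sphereFlow (v i) S).measurable.aemeasurable) < ε →
        ∫ p, (φ (spherePairing A (sphereFlow (v i) S p.1, sphereFlow (v i) S p.2))
          - φ (spherePairing A p)) ∂π ≤ 0 := by
      intro i S h
      have := hmax _ h
      rw [interactionEnergy_map hφs μ (continuous_sphereFlow (v i) S),
        interactionEnergy_eq_integral_prod hφs] at this
      rw [integral_sub (integrable_of_continuous (hflow i S)) hφi]
      linarith
    have hgi : ∀ (i : ι) (S : ℝ), Integrable (fun p =>
        φ (spherePairing A (sphereFlow (v i) S p.1, sphereFlow (v i) S p.2))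
          - φ (spherePairing A p)) π :=
      fun i S => (integrable_of_continuous (hflow i S)).sub hφi
    have hmono := integral_mono (μ := π)
      (f := fun p => 2 * c p * (S ^ 2 * H p - 9 * (S ^ 2) ^ 2))
      (integrable_of_continuous (by fun_prop))
      (integrable_finsetSum _ fun i _ => (hgi i S).add (hgi i (-S)))
      (sum_gain_sphereFlow_ge hsymm hι hA hv (fun s hs => (hψ s hs).le) htan h3.le)
    have hsum := integral_finsetSum (μ := π) Finset.univ
      fun i _ => (hgi i S).add (hgi i (-S))
    simp only [Pi.add_apply] at hsum hmono
    rw [hsum] at hmono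
    have hnonpos : ∑ i, ∫ p,
        ((φ (spherePairing A (sphereFlow (v i) S p.1, sphereFlow (v i) S p.2))
          - φ (spherePairing A p)) +
        (φ (spherePairing A (sphereFlow (v i) (-S) p.1, sphereFlow (v i) (-S) p.2))
          - φ (spherePairing A p))) ∂π ≤ 0 := by
      refine Finset.sum_nonpos fun i _ => ?_
      rw [integral_add (hgi i S) (hgi i (-S))]
      exact add_nonpos (hle i S (h1 (v i))) (hle i (-S) (h2 (v i)))
    have heq : ∫ p, 2 * c p * (S ^ 2 * H p - 9 * (S ^ 2) ^ 2) ∂π =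
        2 * S ^ 2 * (∫ p, c p * H p ∂π - 9 * S ^ 2 * ∫ p, c p ∂π) := by
      rw [← integral_const_mul (9 * S ^ 2), ← integral_sub hcH (hci.const_mul _),
        ← integral_const_mul]
      congr 1
      ext p
      ring
    have hpos : 0 < 2 * S ^ 2 := by
      have : S ≠ 0 := h4
      positivity
    have := nonpos_of_mul_nonpos_right (heq ▸ hmono.trans hnonpos) hpos
    linarith
  have hlim : Filter.Tendsto (fun S : ℝ => 9 * S ^ 2 * ∫ p, c p ∂π) (nhdsWithin 0 {0}ᶜ)
      (nhds 0) := by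
    refine Filter.Tendsto.mono_left ?_ nhdsWithin_le_nhds
    exact Continuous.tendsto' (by fun_prop) _ _ (by simp)
  have hcH0 : ∀ p, 0 ≤ c p * H p := fun p => mul_nonneg (hc0 p) (hH0 p)
  have hzero : ∫ p, c p * H p ∂π = 0 :=
    le_antisymm (ge_of_tendsto hlim hbound) (integral_nonneg hcH0)
  rw [integral_eq_zero_iff_of_nonneg hcH0 hcH] at hzero
  filter_upwards [hzero] with p hp
  -- Either the deficit vanishes, as `ψ > 0`, or the trace does, which forces zero deficit as well.
  rcases mul_eq_zero.1 hp with h | h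
  · rcases mul_eq_zero.1 h with h' | h'
    · exact absurd h' (hψ _ (spherePairing_mem_Icc hA p)).ne'
    · exact (sub_eq_zero.1 h').symm
  · exact inner_eq_of_conformalHessian_eq_zero hι horth hv (norm_unitSphere p.1)
      (norm_unitSphere p.2) h

end LocalMax

/-! ### The main theorem -/

theorem mainTheorem3 (d : ℕ) (hd : 3 ≤ d) (A : Matrix (Fin d) (Fin d) ℝ) (hA : A.IsSymm)
    (lam : ℝ) (hlam : 0 < lam)
    (h1 : sortedEigenvalue hA ⟨0, by omega⟩ = lam)
    (h2 : sortedEigenvalue hA ⟨1, by omega⟩ = lam)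
    (h3 : sortedEigenvalue hA ⟨2, by omega⟩ = lam)
    (hlast : |sortedEigenvalue hA ⟨d - 1, by omega⟩| ≤ lam)
    (φ : ℝ → ℝ)
    (hφ : DifferentiableOn ℝ φ (Set.Icc (-lam) lam))
    (hφ' : DifferentiableOn ℝ (derivWithin φ (Set.Icc (-lam) lam)) (Set.Icc (-lam) lam))
    (hincr : ∀ s ∈ Set.Icc (-lam) lam, 0 < derivWithin φ (Set.Icc (-lam) lam) s)
    (hconv : ∀ s ∈ Set.Icc (-lam) lam,
      0 ≤ derivWithin (derivWithin φ (Set.Icc (-lam) lam)) (Set.Icc (-lam) lam) s) :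
    ∀ μ : ProbabilityMeasure (UnitSphere d),
      (IsWassersteinLocalMax (interactionEnergy A φ) μ → IsGlobalMax (interactionEnergy A φ) μ) ∧
      (IsGlobalMax (interactionEnergy A φ) μ ↔
        ∃ x₀ : UnitSphere d,
          mulVecE A (x₀ : EuclideanSpace ℝ (Fin d)) = lam • (x₀ : EuclideanSpace ℝ (Fin d)) ∧
          (μ : Measure (UnitSphere d)) = Measure.dirac x₀) := by
  have hnorm : ∀ x, ‖mulVecE A x‖ ≤ lam * ‖x‖ := norm_mulVecE_le hA hlam.le
    (abs_sortedEigenvalue_le hA (fun k => Nat.zero_le k) (fun k => Nat.le_sub_one_of_lt k.2)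
      h1 hlast)
  obtain ⟨w, horth, hw⟩ := exists_orthonormal_eigenvectors hA
    (f := Fin.castLE hd) (Fin.castLE_injective hd) (lam := lam) (by
      intro i
      fin_cases i
      · exact h1
      · exact h2
      · exact h3)
  let v : Fin 3 → UnitSphere d := fun i => ⟨w i, by
    rw [mem_sphere_zero_iff_norm]; exact horth.1 i⟩
  have hφs := comp_spherePairing_continuous hnorm hφ.continuousOn
  have hmono := strictMonoOn_Icc_of_derivWithin_pos hφ hincr
  have hmem : lam ∈ Set.Icc (-lam) lam := ⟨by linarith, le_rfl⟩
  have hle : ∀ p, φ (spherePairing A p) ≤ φ lam := fun p =>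
    hmono.monotoneOn (spherePairing_mem_Icc hnorm p) hmem (spherePairing_mem_Icc hnorm p).2
  have hinj : ∀ p, φ (spherePairing A p) = φ lam → spherePairing A p = lam := fun p =>
    hmono.injOn (spherePairing_mem_Icc hnorm p) hmem
  have hglobal : ∀ μ : ProbabilityMeasure (UnitSphere d),
      (∀ᵐ p ∂((μ : Measure (UnitSphere d)).prod (μ : Measure (UnitSphere d))),
        spherePairing A p = lam) → IsGlobalMax (interactionEnergy A φ) μ := fun μ h ν => by
    rw [interactionEnergy_eq_of_ae_eq hφs h]
    exact interactionEnergy_le hφs hle ν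
  have hdirac : ∀ (μ : ProbabilityMeasure (UnitSphere d)) (x₀ : UnitSphere d),
      mulVecE A (x₀ : EuclideanSpace ℝ (Fin d)) = lam • (x₀ : EuclideanSpace ℝ (Fin d)) →
      (μ : Measure (UnitSphere d)) = Measure.dirac x₀ →
      ∀ᵐ p ∂((μ : Measure (UnitSphere d)).prod (μ : Measure (UnitSphere d))),
        spherePairing A p = lam := by
    intro μ x₀ hx₀ hμ
    rw [hμ, Measure.dirac_prod_dirac, ae_dirac_eq, Filter.eventually_pure, spherePairing, hx₀,
      inner_smul_left, real_inner_self_eq_norm_sq, norm_unitSphere]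
    simp
  intro μ
  refine ⟨fun hμ => hglobal μ ?_, fun hμ => ?_, ?_⟩
  · exact ae_pairing_eq_of_isWassersteinLocalMax (v := v) hA (Fintype.card_fin 3) hnorm horth hw
      hφ.continuousOn hφ'.continuousOn hincr
      (fun s hs t ht => tangent_le_of_derivWithin2_nonneg hφ hφ' hconv hs ht) hμ
  · refine exists_eq_dirac_of_ae_pairing_eq hlam hnorm
      (ae_eq_of_le_interactionEnergy hφs hle hinj ?_)
    -- A point mass at an eigenvector attains the upper bound `φ lam / 2`, so any global maximum
    -- must attain it too.
    let δ : ProbabilityMeasure (UnitSphere d) := ⟨Measure.dirac (v 0), inferInstance⟩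
    rw [← interactionEnergy_eq_of_ae_eq hφs (hdirac δ (v 0) (hw 0) rfl)]
    exact hμ δ
  · rintro ⟨x₀, hx₀, hμ⟩
    exact hglobal μ (hdirac μ x₀ hx₀ hμ)
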